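/- All topological spaces are compactly generated, i.e. weak Hausdorff $k$-spaces, and products and fibre products are taken in that category. A \emph{flow} $X$ consists of a set (discrete space) $X^0$ of states, a space $\mathbb{P}X$ of paths, continuous maps $s,t:\mathbb{P}X\to X^0$, and a continuous associative composition $*:\{(x,y)\in\mathbb{P}X\times\mathbb{P}X : t(x)=s(y)\}\to\mathbb{P}X$ with $s(x*y)=s(x)$ and $t(x*y)=t(y)$. A \emph{morphism} $f:X\to Y$ of flows consists of a map $f^0:X^0\to Y^0$ and a continuous map $\mathbb{P}f:\mathbb{P}X\to\mathbb{P}Y$ compatible with $s$, $t$ and $*$; it is \emph{synchronized} if $f^0$ is bijective. An \emph{S-homotopy} $H$ from $X$ to $Y$ is a family $(H_u)_{u\in[0,1]}$ of morphisms of flows $X\to Y$ such that $(u,x)\mapsto H_u(x)$ is continuous on $[0,1]\times(X^0\sqcup\mathbb{P}X)$. A morphism $i:A\to X$ has the \emph{S-homotopy extension property} if it is synchronized and if, for every flow $Y$, every morphism $f:X\to Y$ and every S-homotopy $h$ from $A$ to $Y$ with $h_0=f\circ i$, there is an S-homotopy $H$ from $X$ to $Y$ with $H_0=f$ and $H_u\circ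 i=h_u$ for all $u\in[0,1]$. For a space $Z$, let $\mathrm{Glob}(Z)$ be the flow with states $\{0,1\}$ and path space $Z$, with $s=0$ and $t=1$. A \emph{cofibration} of flows is a morphism that has the left lifting property with respect to every morphism having the right lifting property with respect to the morphisms $\mathrm{Glob}(\mathbf{S}^{n-1})\to\mathrm{Glob}(\mathbf{D}^n)$ ($n\ge 0$, $\mathbf{S}^{-1}=\varnothing$) induced by the inclusions, $R:\{0,1\}\to\{0\}$ and $C:\varnothing\to\{0\}$ (the last two between flows without paths); these are the cofibrations of the model structure on flows whose weak equivalences are the synchronized morphisms inducing a weak homotopy equivalence of path spaces. \textbf{Theorem.} (1) If a morphism of flows $i:A\to X$ has the S-homotopy extension property, then $\mathbb{P}i:\mathbb{P}A\to\mathbb{P}X$ is a closed inclusion of topological spaces (a homeomorphism onto a closed subspace). (2) If $i:A\to X$ is a cofibration of flows, then $\mathbb{P}i:\mathbb{P}A\to\mathbb{P}X$ is a closed inclusion of topological spaces. -/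

import Mathlib

open CategoryTheory Topology

universe u

/-- A topological space is weak Hausdorff if every continuous image of a compact Hausdorff space
in it is closed. -/
class WeakHausdorffSpace (X : Type u) [TopologicalSpace X] : Prop where
  isClosed_range : ∀ (K : Type u) [TopologicalSpace K] [CompactSpace K] [T2Space K] (f : K → X),
    Continuous f → IsClosed (Set.range f)

instance WeakHausdorffSpace.of_t2 (X : Type u) [TopologicalSpace X] [T2Space X] :
    WeakHausdorffSpace X where
  isClosed_range _ _ _ _ _ hf := (isCompact_range hf).isClosed

/-- A flow: a set of states (viewed as a discrete space), a compactly generated (that is, weak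
Hausdorff `k`-) space of non-constant execution paths, continuous source and target maps, and a
continuous associative composition law on composable pairs of paths.

The space of composable pairs is the fibre product in the category of compactly generated spaces:
the `k`-ification of the subspace topology inherited from the product topology. -/
structure PathFlow where
  State : Type u
  Path : Type u
  [topPath : TopologicalSpace Path]
  [compactlyGeneratedPath : CompactlyGeneratedSpace Path]
  [weakHausdorffPath : WeakHausdorffSpace Path]
  src : Path → State
  tgt : Path → State
  continuous_src : Continuous[topPath, ⊥] src
  continuous_tgt : Continuous[topPath, ⊥] tgt
  comp : (x y : Path) → tgt x = src y → Path
  continuous_comp :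
    Continuous[TopologicalSpace.compactlyGenerated.{u} {p : Path × Path // tgt p.1 = src p.2},
      topPath] (fun p => comp p.1.1 p.1.2 p.2)
  src_comp : ∀ (x y : Path) (h : tgt x = src y), src (comp x y h) = src x
  tgt_comp : ∀ (x y : Path) (h : tgt x = src y), tgt (comp x y h) = tgt y
  comp_assoc : ∀ (x y z : Path) (hxy : tgt x = src y) (hyz : tgt y = src z),
    comp (comp x y hxy) z ((tgt_comp x y hxy).trans hyz) =
      comp x (comp y z hyz) (hxy.trans (src_comp y z hyz).symm)

namespace PathFlow

attribute [instance] topPath compactlyGeneratedPath weakHausdorffPath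

/-- A morphism of flows. -/
@[ext]
structure Hom (X Y : PathFlow.{u}) where
  onState : X.State → Y.State
  onPath : X.Path → Y.Path
  continuous_onPath : Continuous onPath
  map_src : ∀ x, onState (X.src x) = Y.src (onPath x)
  map_tgt : ∀ x, onState (X.tgt x) = Y.tgt (onPath x)
  map_comp : ∀ (x y : X.Path) (h : X.tgt x = X.src y),
    onPath (X.comp x y h) = Y.comp (onPath x) (onPath y)
      ((map_tgt x).symm.trans ((congrArg onState h).trans (map_src y)))

/-- The category of flows. -/
instance : Category PathFlow.{u} where
  Hom := Hom
  id X := ⟨id, id, continuous_id, fun _ => rfl, fun _ => rfl, fun _ _ _ => rfl⟩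
  comp f g :=
    { onState := g.onState ∘ f.onState
      onPath := g.onPath ∘ f.onPath
      continuous_onPath := g.continuous_onPath.comp f.continuous_onPath
      map_src := fun x => (congrArg g.onState (f.map_src x)).trans (g.map_src _)
      map_tgt := fun x => (congrArg g.onState (f.map_tgt x)).trans (g.map_tgt _)
      map_comp := fun x y h => (congrArg g.onPath (f.map_comp x y h)).trans (g.map_comp _ _ _) }

/-- A morphism of flows is synchronized if it is bijective on states. -/
def Synchronized {X Y : PathFlow.{u}} (f : X ⟶ Y) : Prop :=
  Function.Bijective f.onState

/-- An S-homotopy between morphisms of flows from `X` to `Y`: a family `H u`, `u ∈ [0,1]`, of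
morphisms of flows such that `(u, x) ↦ H u x` is continuous on `[0,1] × X`, where the underlying
space of `X` is the disjoint sum of the discrete space of states and of the path space.
(As `[0,1]` is compact Hausdorff, `[0,1] × X.Path` with the product topology is already a
`k`-space, so this is also the product of compactly generated spaces.) -/
structure SHomotopy (X Y : PathFlow.{u}) where
  toFun : unitInterval → (X ⟶ Y)
  continuous_onState : ∀ a : X.State, Continuous[inferInstance, ⊥] fun u => (toFun u).onState a
  continuous_onPath : Continuous fun p : unitInterval × X.Path => (toFun p.1).onPath p.2

/-- The S-homotopy extension property of a morphism `i : A ⟶ X` with respect to a flow `Y`. -/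
def HasSHEPFor {A X : PathFlow.{u}} (i : A ⟶ X) (Y : PathFlow.{u}) : Prop :=
  ∀ (f : X ⟶ Y) (h : SHomotopy A Y), h.toFun 0 = i ≫ f →
    ∃ H : SHomotopy X Y, H.toFun 0 = f ∧ ∀ t, i ≫ H.toFun t = h.toFun t

/-- A morphism of flows has the S-homotopy extension property if it is synchronized and has the
S-homotopy extension property with respect to every flow. -/
def HasSHEP {A X : PathFlow.{u}} (i : A ⟶ X) : Prop :=
  Synchronized i ∧ ∀ Y : PathFlow.{u}, HasSHEPFor i Y

/-- The class of morphisms of flows inducing a closed inclusion of path spaces. -/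
def closedInclusions : MorphismProperty PathFlow.{u} :=
  fun _ _ f => IsClosedEmbedding f.onPath

/-- The globe of a compactly generated space `Z`: two states `0` (`false`) and `1` (`true`), and
the path space `Z`, all paths going from `0` to `1`. -/
def glob (Z : Type u) [TopologicalSpace Z] [CompactlyGeneratedSpace Z] [WeakHausdorffSpace Z] :
    PathFlow.{u} where
  State := ULift.{u} Bool
  Path := Z
  src _ := ⟨false⟩
  tgt _ := ⟨true⟩
  continuous_src := @continuous_const _ _ _ ⊥ _
  continuous_tgt := @continuous_const _ _ _ ⊥ _
  comp _ _ h := absurd (congrArg ULift.down h) Bool.noConfusion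
  continuous_comp := by
    have : IsEmpty {p : Z × Z // (⟨true⟩ : ULift.{u} Bool) = ⟨false⟩} :=
      ⟨fun p => absurd (congrArg ULift.down p.2) Bool.noConfusion⟩
    exact @continuous_of_const _ _ (_) (_) _ fun p => isEmptyElim p
  src_comp _ _ _ := rfl
  tgt_comp _ _ _ := rfl
  comp_assoc _ _ _ h := absurd (congrArg ULift.down h) Bool.noConfusion

/-- The morphism of globes induced by a continuous map. -/
def globMap {Z W : Type u} [TopologicalSpace Z] [CompactlyGeneratedSpace Z] [WeakHausdorffSpace Z]
    [TopologicalSpace W] [CompactlyGeneratedSpace W] [WeakHausdorffSpace W] (f : C(Z, W)) :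
    glob Z ⟶ glob W :=
  Hom.mk id f f.continuous (fun _ => rfl) (fun _ => rfl)
    (fun _ _ h => absurd (congrArg ULift.down h) Bool.noConfusion)

/-- The flow with set of states `S` and no non-constant execution path. -/
def achronal (S : Type u) : PathFlow.{u} where
  State := S
  Path := PEmpty
  src := PEmpty.elim
  tgt := PEmpty.elim
  continuous_src := @continuous_of_const _ _ (_) (_) _ fun x => x.elim
  continuous_tgt := @continuous_of_const _ _ (_) (_) _ fun x => x.elim
  comp x := x.elim
  continuous_comp := @continuous_of_const _ _ (_) (_) _ fun p => p.1.1.elim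
  src_comp x := x.elim
  tgt_comp x := x.elim
  comp_assoc x := x.elim

/-- The morphism of flows without paths induced by a map of sets. -/
def achronalMap {S T : Type u} (f : S → T) : achronal S ⟶ achronal T :=
  Hom.mk f id continuous_id (fun x => x.elim) (fun x => x.elim) (fun x => x.elim)

instance (n : ℕ) : T2Space (TopCat.disk.{u} n) :=
  inferInstanceAs (T2Space (ULift _))

instance (n : ℕ) : T2Space (TopCat.diskBoundary.{u} n) :=
  inferInstanceAs (T2Space (ULift _))

/-- The morphisms `Glob(S^{n-1}) ⟶ Glob(D^n)`, `n ≥ 0`, induced by the inclusions. -/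
noncomputable def globSphereToDisk (n : ℕ) :
    glob (TopCat.diskBoundary.{u} n) ⟶ glob (TopCat.disk.{u} n) :=
  globMap (TopCat.diskBoundaryInclusion n).hom

/-- The morphism `R : {0,1} ⟶ {0}`. -/
def morphismR : achronal (ULift.{u} Bool) ⟶ achronal PUnit.{u + 1} :=
  achronalMap fun _ => PUnit.unit

/-- The morphism `C : ∅ ⟶ {0}`. -/
def morphismC : achronal PEmpty.{u + 1} ⟶ achronal PUnit.{u + 1} :=
  achronalMap PEmpty.elim

/-- The set of generating cofibrations: the morphisms `Glob(S^{n-1}) ⟶ Glob(D^n)` for `n ≥ 0`,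
together with `R` and `C`. -/
inductive generatingCofibrations : MorphismProperty PathFlow.{u}
  | globe (n : ℕ) : generatingCofibrations (globSphereToDisk n)
  | R : generatingCofibrations morphismR
  | C : generatingCofibrations morphismC

/-- The cofibrations of the model structure on flows: the morphisms having the left lifting
property with respect to every morphism that has the right lifting property with respect to the
generating cofibrations. -/
def cofibrations : MorphismProperty PathFlow.{u} :=
  generatingCofibrations.rlp.llp

end PathFlow

/-! ### Weak Hausdorff spaces and `k`-ification. -/

section WeakHausdorff

variable {X : Type u} [TopologicalSpace X]

/-! Both statements come from one test flow. The cone of `A` has a single state, and its paths form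
the open cone on the path space of `A`. Two points of the cone compose by composing their bases and
taking the minimum of their heights; if the bases are not composable, the result is the apex, which
is absorbing. Inclusion at height `t` is then a morphism from `A` to its cone for every `t` in
`[0,1]`. It is constant at the apex for `t = 0` and a closed inclusion on paths for `t = 1`.

Suppose that the inclusion at height `1` factors as `i` followed by a morphism `g`. By
`IsClosedEmbedding.of_comp_weakHausdorff`, a closed embedding into a compactly generated weak
Hausdorff space can be cancelled on the left, so `i` is a closed inclusion on paths. It remains to
produce `g`. Under the S-homotopy extension property, the homotopy of inclusions starts at a
constant morphism, which extends to `X`; the end of the extended homotopy is `g`. For a cofibration,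
`g` is a lift against the map from the cone to the terminal flow. This map has the required right
lifting property because maps from spheres to a cone extend radially over discs
(`exists_extension_sphere`) and because the cone has exactly one state.

The technical work is to show that the cone is a flow: the open cone must be weak Hausdorff, and the
composition must be continuous (`continuous_coneComp`), which need only be tested on compact
Hausdorff spaces. -/

/-- A continuous map from a compact Hausdorff space to its `k`-ified target is continuous. -/
theorem Continuous.to_compactlyGenerated {K : Type u} [TopologicalSpace K] [CompactSpace K]
    [T2Space K] {g : K → X} (hg : Continuous g) :
    Continuous[inferInstance, TopologicalSpace.compactlyGenerated.{u} X] g := by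
  let f : (Σ (i : (S : CompHaus.{u}) × C(S, X)), i.fst) → X := fun ⟨⟨_, i⟩, s⟩ => i s
  have h : Continuous[inferInstance, TopologicalSpace.compactlyGenerated.{u} X] f :=
    continuous_coinduced_rng
  have := @Continuous.comp _ _ _ _ _ (TopologicalSpace.compactlyGenerated.{u} X) _ _ h
    (continuous_sigmaMk (σ := fun i : (S : CompHaus.{u}) × C(S, X) => i.fst)
      (i := ⟨CompHaus.of K, ⟨g, hg⟩⟩))
  exact this

theorem compactlyGenerated_le : TopologicalSpace.compactlyGenerated.{u} X ≤ ‹_› := by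
  rw [← continuous_id_iff_le]
  exact continuous_from_compactlyGenerated _ fun _ g => g.continuous

/-- The `k`-ification of a space is a `k`-space. -/
theorem compactlyGeneratedSpace_compactlyGenerated :
    @CompactlyGeneratedSpace X (TopologicalSpace.compactlyGenerated.{u} X) := by
  refine @compactlyGeneratedSpace_of_continuous_maps X
    (TopologicalSpace.compactlyGenerated.{u} X) ?_
  intro Y _ f hf
  refine continuous_from_compactlyGenerated f fun S g => ?_
  exact hf S g g.continuous.to_compactlyGenerated

variable [WeakHausdorffSpace X]

/-- The `k`-ification of a weak Hausdorff space is weak Hausdorff. -/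
theorem weakHausdorffSpace_compactlyGenerated :
    @WeakHausdorffSpace X (TopologicalSpace.compactlyGenerated.{u} X) := by
  refine @WeakHausdorffSpace.mk X (TopologicalSpace.compactlyGenerated.{u} X) ?_
  intro K _ _ _ f hf
  have hf' : Continuous f := continuous_le_rng compactlyGenerated_le hf
  exact (WeakHausdorffSpace.isClosed_range K f hf').mono compactlyGenerated_le

theorem WeakHausdorffSpace.isClosed_singleton (x : X) : IsClosed ({x} : Set X) := by
  have := WeakHausdorffSpace.isClosed_range PUnit.{u + 1} (fun _ => x) continuous_const
  rwa [Set.range_const] at this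

variable {K : Type u} [TopologicalSpace K] [CompactSpace K] [T2Space K]

/-- A map from a compact Hausdorff space to a weak Hausdorff space sends a closed subset on which
it is continuous to a closed subset. -/
theorem ContinuousOn.isClosed_image_of_weakHausdorff {f : K → X} {s : Set K}
    (hf : ContinuousOn f s) (hs : IsClosed s) : IsClosed (f '' s) := by
  have : CompactSpace s := isCompact_iff_compactSpace.1 hs.isCompact
  have := WeakHausdorffSpace.isClosed_range s (s.domRestrict f) hf.domRestrict
  rwa [Set.range_domRestrict] at this

/-- The coincidence set of two continuous maps from a compact Hausdorff space to a weak Hausdorff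
space is closed. -/
theorem WeakHausdorffSpace.isClosed_eq {f g : K → X} (hf : Continuous f) (hg : Continuous g) :
    IsClosed {k | f k = g k} := by
  -- `F` is a closed map from a normal space. Disjoint open neighbourhoods of two fibres therefore
  -- shrink to saturated ones, which separate `f k` from `g k` on the image of `F`.
  let F : K ⊕ K → X := Sum.elim f g
  have hF : Continuous F := hf.sumElim hg
  have hcl : IsClosedMap F := fun s hs => hF.continuousOn.isClosed_image_of_weakHausdorff hs
  rw [← isOpen_compl_iff, isOpen_iff_mem_nhds]
  intro k hk
  obtain ⟨U, V, hU, hV, hfU, hgV, hUV⟩ := normal_separation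
    ((isClosed_singleton (f k)).preimage hF) ((isClosed_singleton (g k)).preimage hF)
    (Disjoint.preimage F (Set.disjoint_singleton.2 hk))
  have hU' : IsOpen (F '' Uᶜ)ᶜ := (hcl _ hU.isClosed_compl).isOpen_compl
  have hV' : IsOpen (F '' Vᶜ)ᶜ := (hcl _ hV.isClosed_compl).isOpen_compl
  have h1 : f ⁻¹' (F '' Uᶜ)ᶜ ∈ 𝓝 k := (hU'.preimage hf).mem_nhds <| by
    rintro ⟨z, hz, hzk⟩
    exact hz (hfU hzk)
  have h2 : g ⁻¹' (F '' Vᶜ)ᶜ ∈ 𝓝 k := (hV'.preimage hg).mem_nhds <| by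
    rintro ⟨z, hz, hzk⟩
    exact hz (hgV hzk)
  filter_upwards [h1, h2] with l hl1 hl2 hl
  have hlU : Sum.inl l ∈ U := by
    by_contra h
    exact hl1 ⟨_, h, rfl⟩
  have hlV : Sum.inl l ∈ V := by
    by_contra h
    exact hl2 ⟨_, h, hl⟩
  exact Set.disjoint_left.1 hUV hlU hlV

/-- A continuous map to a compactly generated weak Hausdorff space is a closed embedding as soon
as it is one after composition with a continuous map. -/
theorem Topology.IsClosedEmbedding.of_comp_weakHausdorff {A Y : Type*} [TopologicalSpace A]
    [TopologicalSpace Y] [CompactlyGeneratedSpace X] {e : A → X} {g : X → Y}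
    (he : Continuous e) (hg : Continuous g) (hge : IsClosedEmbedding (g ∘ e)) :
    IsClosedEmbedding e := by
  refine ⟨.of_comp he hg hge.isEmbedding, CompactlyGeneratedSpace.isClosed' ?_⟩
  intro K _ _ _ f hf
  -- On the closed set `C`, inverting `g ∘ e` gives a continuous `r : C → A`, the only candidate for
  -- a preimage under `e`. Hence `f ⁻¹' Set.range e` is the coincidence set of `e ∘ r` and `f`.
  let C : Set K := (g ∘ f) ⁻¹' Set.range (g ∘ e)
  have hC : IsClosed C := hge.isClosed_range.preimage (hg.comp hf)
  have : CompactSpace C := isCompact_iff_compactSpace.1 hC.isCompact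
  let r : C → A := fun k => hge.isEmbedding.toHomeomorph.symm ⟨g (f k), k.2⟩
  have hr : Continuous r := hge.isEmbedding.toHomeomorph.symm.continuous.comp <|
    Continuous.subtype_mk (hg.comp (hf.comp continuous_subtype_val)) _
  have hgr (k : C) : g (e (r k)) = g (f k) :=
    congrArg Subtype.val (hge.isEmbedding.toHomeomorph.apply_symm_apply ⟨g (f k), k.2⟩)
  have hcl := hC.isClosedEmbedding_subtypeVal.isClosedMap _
    (WeakHausdorffSpace.isClosed_eq (he.comp hr) (hf.comp continuous_subtype_val))
  convert hcl using 1
  ext k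
  constructor
  · rintro ⟨a, ha⟩
    have hk : k ∈ C := ⟨a, congrArg g ha⟩
    refine ⟨⟨k, hk⟩, ?_, rfl⟩
    have : r ⟨k, hk⟩ = a := hge.injective ((hgr ⟨k, hk⟩).trans (congrArg g ha.symm))
    change e (r ⟨k, hk⟩) = f k
    rw [this, ha]
  · rintro ⟨k, hk, rfl⟩
    exact ⟨r k, hk⟩

end WeakHausdorff

/-! ### The open cone on a space. -/

/-- The set underlying the open cone on `P`: an apex, and the points of `P` at all positive
heights. -/
def OpenCone (P : Type u) : Type u := Option (P × {t : ℝ // 0 < t})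

namespace OpenCone

section Set

variable {P : Type u}

def apex : OpenCone P := none

/-- The point over `x` at height `t`, by convention the apex if `t ≤ 0`. -/
noncomputable def mk (x : P) (t : ℝ) : OpenCone P :=
  if h : 0 < t then some (x, ⟨t, h⟩) else none

def height : OpenCone P → ℝ
  | none => 0
  | some (_, t) => t

/-- The base point of a point of the cone, with a default value at the apex. -/
def base (x₀ : P) : OpenCone P → P
  | none => x₀
  | some (x, _) => x

theorem mk_of_pos (x : P) {t : ℝ} (h : 0 < t) : mk x t = some (x, ⟨t, h⟩) := dif_pos h

theorem mk_of_nonpos (x : P) {t : ℝ} (h : t ≤ 0) : mk x t = apex := dif_neg h.not_gt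

@[elab_as_elim]
theorem rec_mk {motive : OpenCone P → Prop} (apex : motive apex)
    (mk : ∀ x t, 0 < t → motive (mk x t)) (q : OpenCone P) : motive q := by
  rcases q with _ | ⟨x, t, ht⟩
  · exact apex
  · rw [← mk_of_pos x ht]
    exact mk x t ht

@[simp] theorem height_apex : height (apex : OpenCone P) = 0 := rfl

theorem height_mk (x : P) (t : ℝ) : height (mk x t) = max t 0 := by
  rcases lt_or_ge 0 t with h | h
  · rw [mk_of_pos x h, max_eq_left h.le]
    rfl
  · rw [mk_of_nonpos x h, max_eq_right h]
    rfl

theorem height_mk_of_pos (x : P) {t : ℝ} (h : 0 < t) : height (mk x t) = t := by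
  rw [height_mk, max_eq_left h.le]

theorem base_mk (x₀ x : P) {t : ℝ} (h : 0 < t) : base x₀ (mk x t) = x := by
  rw [mk_of_pos x h]
  rfl

theorem height_nonneg (q : OpenCone P) : 0 ≤ height q := by
  rcases q with _ | ⟨x, t, ht⟩
  exacts [le_rfl, ht.le]

theorem eq_apex_of_height_le {q : OpenCone P} (h : height q ≤ 0) : q = apex := by
  rcases q with _ | ⟨x, t, ht⟩
  exacts [rfl, absurd ht h.not_gt]

theorem mk_base_height (x₀ : P) (q : OpenCone P) : mk (base x₀ q) (height q) = q := by
  rcases q with _ | ⟨x, t, ht⟩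
  exacts [mk_of_nonpos _ le_rfl, mk_of_pos x ht]

/-- Multiplication of the height by a scalar, negative heights being sent to the apex. -/
noncomputable def scale (s : ℝ) : OpenCone P → OpenCone P
  | none => none
  | some (x, t) => mk x (s * t)

theorem scale_eq_mk (x₀ : P) (s : ℝ) (q : OpenCone P) :
    scale s q = mk (base x₀ q) (s * height q) := by
  rcases q with _ | ⟨x, t, ht⟩
  · exact (mk_of_nonpos _ (mul_zero s).le).symm
  · rfl

theorem height_scale (s : ℝ) (q : OpenCone P) : height (scale s q) = max (s * height q) 0 := by
  rcases q with _ | ⟨x, t, ht⟩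
  · change (0 : ℝ) = max (s * 0) 0
    simp
  · exact height_mk _ _

theorem one_scale (q : OpenCone P) : scale 1 q = q := by
  rcases q with _ | ⟨x, t, ht⟩
  · rfl
  · change mk x (1 * t) = _
    rw [one_mul, mk_of_pos x ht]

end Set

variable {P : Type u} [TopologicalSpace P]

/-- The topology of the open cone for which the points of small height form a basis of
neighbourhoods of the apex. -/
instance : TopologicalSpace (OpenCone P) where
  IsOpen U := IsOpen {p : P × ℝ | 0 < p.2 ∧ mk p.1 p.2 ∈ U} ∧
    (apex ∈ U → ∃ ε > 0, ∀ q, height q < ε → q ∈ U)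
  isOpen_univ := by
    refine ⟨?_, fun _ => ⟨1, one_pos, fun _ _ => trivial⟩⟩
    simpa using isOpen_lt continuous_const continuous_snd
  isOpen_inter U V hU hV := by
    refine ⟨?_, fun h => ?_⟩
    · convert hU.1.inter hV.1 using 1
      ext p
      simp only [Set.mem_ofPred_eq, Set.mem_inter_iff]
      tauto
    · obtain ⟨ε, hε, h1⟩ := hU.2 h.1
      obtain ⟨δ, hδ, h2⟩ := hV.2 h.2
      exact ⟨min ε δ, lt_min hε hδ, fun q hq =>
        ⟨h1 q (hq.trans_le (min_le_left _ _)), h2 q (hq.trans_le (min_le_right _ _))⟩⟩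
  isOpen_sUnion S hS := by
    refine ⟨?_, ?_⟩
    · have : {p : P × ℝ | 0 < p.2 ∧ mk p.1 p.2 ∈ ⋃₀ S} =
          ⋃ U ∈ S, {p : P × ℝ | 0 < p.2 ∧ mk p.1 p.2 ∈ U} := by
        ext p
        simp only [Set.mem_ofPred_eq, Set.mem_sUnion, Set.mem_iUnion, exists_prop]
        tauto
      rw [this]
      exact isOpen_biUnion fun U hU => (hS U hU).1
    · rintro ⟨U, hU, h⟩
      obtain ⟨ε, hε, h1⟩ := (hS U hU).2 h
      exact ⟨ε, hε, fun q hq => ⟨U, hU, h1 q hq⟩⟩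

theorem isOpen_iff {U : Set (OpenCone P)} :
    IsOpen U ↔ IsOpen {p : P × ℝ | 0 < p.2 ∧ mk p.1 p.2 ∈ U} ∧
      (apex ∈ U → ∃ ε > 0, ∀ q, height q < ε → q ∈ U) := Iff.rfl

theorem continuous_height : Continuous (height : OpenCone P → ℝ) := by
  rw [continuous_def]
  intro s hs
  rw [isOpen_iff]
  constructor
  · convert (isOpen_lt continuous_const continuous_snd).inter (hs.preimage continuous_snd)
      using 1
    ext p
    simp only [Set.mem_ofPred_eq, Set.mem_preimage, Set.mem_inter_iff]
    refine and_congr_right fun h => ?_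
    rw [height_mk_of_pos _ h]
  · intro h
    obtain ⟨ε, hε, hs'⟩ := Metric.isOpen_iff.1 hs 0 h
    refine ⟨ε, hε, fun q hq => hs' ?_⟩
    rw [Metric.mem_ball, Real.dist_0_eq_abs, abs_of_nonneg (height_nonneg q)]
    exact hq

/-- Neighbourhoods of the apex are controlled by the height alone, so nothing needs to be known
about base points. This is how continuity at the apex is checked throughout. -/
theorem continuousAt_of_eq_apex {Z : Type*} [TopologicalSpace Z] {g : Z → OpenCone P} {z : Z}
    (hz : g z = apex) (hg : ContinuousAt (fun w => height (g w)) z) : ContinuousAt g z := by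
  rw [ContinuousAt, hz, tendsto_nhds]
  intro U hU hap
  obtain ⟨ε, hε, h⟩ := (isOpen_iff.1 hU).2 hap
  have : ∀ᶠ w in 𝓝 z, height (g w) < ε := by
    refine hg.eventually_lt continuousAt_const ?_
    rw [hz]
    exact hε
  filter_upwards [this] with w hw using h _ hw

theorem _root_.ContinuousAt.openCone_mk {Z : Type*} [TopologicalSpace Z] {a : Z → P} {t : Z → ℝ}
    {z : Z} (ha : ContinuousAt a z) (ht : ContinuousAt t z) (hz : 0 < t z) :
    ContinuousAt (fun w => mk (a w) (t w)) z := by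
  rw [ContinuousAt, tendsto_nhds]
  intro U hU hmem
  have := (ha.prodMk ht).eventually ((isOpen_iff.1 hU).1.mem_nhds ⟨hz, hmem⟩)
  filter_upwards [this] with w hw using hw.2

theorem continuous_mk : Continuous fun p : P × ℝ => mk p.1 p.2 := by
  rw [continuous_iff_continuousAt]
  intro p
  rcases lt_or_ge 0 p.2 with h | h
  · exact continuousAt_fst.openCone_mk continuousAt_snd h
  · refine continuousAt_of_eq_apex (mk_of_nonpos _ h) ?_
    simp only [height_mk]
    fun_prop

/-- Away from the apex the cone is the product of `P` with the positive half-line, and the default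
value `x₀` plays no role there. -/
theorem continuousAt_base (x₀ : P) {q : OpenCone P} (hq : 0 < height q) :
    ContinuousAt (base x₀) q := by
  rw [ContinuousAt, tendsto_nhds]
  intro V hV hmem
  have : IsOpen {q : OpenCone P | 0 < height q ∧ base x₀ q ∈ V} := by
    rw [isOpen_iff]
    refine ⟨?_, fun h => absurd h.1 (lt_irrefl 0)⟩
    convert (isOpen_lt (continuous_const (y := (0 : ℝ))) continuous_snd).inter
      (hV.preimage continuous_fst) using 1
    ext p
    simp only [Set.mem_ofPred_eq, Set.mem_preimage, Set.mem_inter_iff]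
    refine and_congr_right fun h => ?_
    rw [height_mk_of_pos _ h, base_mk _ _ h]
    exact and_iff_right h
  filter_upwards [this.mem_nhds ⟨hq, hmem⟩] with w hw using hw.2

theorem continuous_scale : Continuous fun p : ℝ × OpenCone P => scale p.1 p.2 := by
  have hh : Continuous fun p : ℝ × OpenCone P => height p.2 := continuous_height.comp continuous_snd
  rw [continuous_iff_continuousAt]
  rintro ⟨s, q⟩
  rcases lt_or_ge 0 (s * height q) with h | h
  · have hq : 0 < height q := (height_nonneg q).lt_of_ne fun h0 => by simp [← h0] at h
    have hP : Nonempty P := by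
      rcases q with _ | ⟨x, t⟩
      exacts [absurd hq (lt_irrefl 0), ⟨x⟩]
    obtain ⟨x₀⟩ := hP
    simp only [scale_eq_mk x₀]
    exact ((continuousAt_base x₀ hq).comp (f := fun p : ℝ × OpenCone P => p.2)
      continuousAt_snd).openCone_mk
        (t := fun p : ℝ × OpenCone P => p.1 * height p.2) (z := (s, q))
        (continuousAt_fst.mul hh.continuousAt) h
  · refine continuousAt_of_eq_apex (eq_apex_of_height_le ?_) ?_
    · rw [height_scale, max_eq_right h]
    · simp only [height_scale]
      fun_prop

/-- The inclusion of the base at a positive height is a closed embedding. -/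
theorem isClosedEmbedding_mk {t : ℝ} (ht : 0 < t) :
    IsClosedEmbedding fun x : P => mk x t := by
  have hcont : Continuous fun x : P => mk x t :=
    continuous_mk.comp (continuous_id.prodMk continuous_const)
  refine ⟨⟨⟨?_⟩, fun x y hxy => ?_⟩, ?_⟩
  · refine le_antisymm hcont.le_induced fun V hV => ?_
    -- The witness is the cone over `V` with its apex removed.
    refine ⟨{q | 0 < height q ∧ ∃ x ∈ V, q = mk x (height q)}, ?_, ?_⟩
    · rw [isOpen_iff]
      refine ⟨?_, fun h => absurd h.1 (lt_irrefl 0)⟩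
      convert (isOpen_lt (continuous_const (y := (0 : ℝ))) continuous_snd).inter
        (hV.preimage continuous_fst) using 1
      ext p
      simp only [Set.mem_ofPred_eq, Set.mem_preimage, Set.mem_inter_iff]
      refine and_congr_right fun h => ?_
      rw [height_mk_of_pos _ h]
      refine ⟨?_, fun hp => ⟨h, p.1, hp, rfl⟩⟩
      rintro ⟨-, x, hx, hpx⟩
      have := congrArg (base x) hpx
      rw [base_mk _ _ h, base_mk _ _ h] at this
      rwa [this]
    · ext x
      simp only [Set.mem_preimage, Set.mem_ofPred_eq, height_mk_of_pos _ ht]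
      refine ⟨?_, fun hx => ⟨ht, x, hx, rfl⟩⟩
      rintro ⟨-, y, hy, hxy⟩
      have := congrArg (base x) hxy
      rw [base_mk _ _ ht, base_mk _ _ ht] at this
      rwa [this]
  · have := congrArg (base x) hxy
    simpa only [base_mk _ _ ht] using this
  · convert isClosed_eq continuous_height (continuous_const (y := t)) using 1
    · ext q
      refine ⟨?_, fun hq => ?_⟩
      · rintro ⟨x, rfl⟩
        exact height_mk_of_pos _ ht
      · rcases q with _ | ⟨x, s, hs⟩
        · exact absurd hq ht.ne
        · refine ⟨x, ?_⟩
          obtain rfl : s = t := hq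
          exact mk_of_pos x ht

/-- A point at height `t > 0` outside the image is separated from it in two stages: first by height,
among the points of `K` lying over `x`, then by base point, among the points of `K` of height close
to `t`. At the apex, compactness bounds the heights of the image away from `0`. -/
instance [WeakHausdorffSpace P] : WeakHausdorffSpace (OpenCone P) where
  isClosed_range K _ _ _ f hf := by
    have hhf : Continuous fun k => height (f k) := continuous_height.comp hf
    rw [← isOpen_compl_iff, isOpen_iff]
    constructor
    · rw [isOpen_iff_mem_nhds]
      rintro ⟨x, t⟩ ⟨ht : 0 < t, hx : mk x t ∉ Set.range f⟩
      -- The cutoff `t / 2` keeps `L` away from the apex, so that the base point depends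
      -- continuously on `k ∈ L`.
      let L : Set K := {k | t / 2 ≤ height (f k)}
      have hL : IsClosed L := isClosed_le continuous_const hhf
      have hbase : ContinuousOn (fun k => base x (f k)) L := fun k hk =>
        ((continuousAt_base x ((half_pos ht).trans_le hk)).comp
          hf.continuousAt).continuousWithinAt
      have hC : IsClosed (L ∩ (fun k => base x (f k)) ⁻¹' {x}) :=
        hbase.preimage_isClosed_of_isClosed hL (WeakHausdorffSpace.isClosed_singleton x)
      have himg : IsClosed ((fun k => height (f k)) '' (L ∩ (fun k => base x (f k)) ⁻¹' {x})) :=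
        (hC.isCompact.image hhf).isClosed
      have htn : t ∉ (fun k => height (f k)) '' (L ∩ (fun k => base x (f k)) ⁻¹' {x}) := by
        rintro ⟨k, ⟨-, hk⟩, hkt⟩
        refine hx ⟨k, ?_⟩
        rw [← mk_base_height x (f k)]
        exact congrArg₂ mk hk hkt
      obtain ⟨ε, hε, hball⟩ := Metric.mem_nhds_iff.1
        (Filter.inter_mem (himg.isOpen_compl.mem_nhds htn) (lt_mem_nhds (half_lt_self ht)))
      -- The closed condition with `ε / 2` makes `D` compact while its heights stay in the `ε`-ball,
      -- which no point of `L` over `x` reaches. Hence `x` is not a base point of `D`.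
      let D : Set K := L ∩ {k | |height (f k) - t| ≤ ε / 2}
      have hD : IsClosed D :=
        hL.inter (isClosed_le (hhf.sub continuous_const).abs continuous_const)
      have hDimg := (hbase.mono Set.inter_subset_left).isClosed_image_of_weakHausdorff hD
      have hxD : x ∉ (fun k => base x (f k)) '' D := by
        rintro ⟨k, ⟨hkL, hk : |height (f k) - t| ≤ ε / 2⟩, hkx⟩
        have : height (f k) ∈ Metric.ball t ε := by
          rw [Metric.mem_ball, Real.dist_eq]
          linarith
        exact (hball this).1 ⟨k, ⟨hkL, hkx⟩, rfl⟩
      filter_upwards [prod_mem_nhds (hDimg.isOpen_compl.mem_nhds hxD)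
        (Metric.ball_mem_nhds t (half_pos hε))]
      rintro ⟨y, s⟩ ⟨hy : y ∉ _, hs : s ∈ Metric.ball t (ε / 2)⟩
      have hst : t / 2 < s := (hball (Metric.ball_subset_ball (by linarith) hs)).2
      have hs0 : 0 < s := (half_pos ht).trans hst
      refine ⟨hs0, ?_⟩
      rintro ⟨k, hk : f k = mk y s⟩
      have hks : height (f k) = s := by rw [hk, height_mk_of_pos _ hs0]
      refine hy ⟨k, ⟨?_, ?_⟩, ?_⟩
      · change t / 2 ≤ height (f k)
        rw [hks]
        exact hst.le
      · change |height (f k) - t| ≤ ε / 2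
        rw [hks, ← Real.dist_eq]
        exact (Metric.mem_ball.1 hs).le
      · change base x (f k) = y
        rw [hk, base_mk _ _ hs0]
    · intro hap
      have himg : IsClosed (Set.range fun k => height (f k)) := (isCompact_range hhf).isClosed
      have h0 : (0 : ℝ) ∉ Set.range fun k => height (f k) := by
        rintro ⟨k, hk⟩
        exact hap ⟨k, eq_apex_of_height_le hk.le⟩
      obtain ⟨ε, hε, hball⟩ := Metric.mem_nhds_iff.1 (himg.isOpen_compl.mem_nhds h0)
      refine ⟨ε, hε, ?_⟩
      rintro q hq ⟨k, rfl⟩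
      refine hball ?_ ⟨k, rfl⟩
      rw [Metric.mem_ball, Real.dist_0_eq_abs, abs_of_nonneg (height_nonneg _)]
      exact hq

/-- A continuous map from a unit sphere to an open cone extends radially to the whole space. -/
theorem exists_extension_sphere {E : Type*} [NormedAddCommGroup E] [NormedSpace ℝ E]
    [ProperSpace E] {f : Metric.sphere (0 : E) 1 → OpenCone P} (hf : Continuous f) :
    ∃ F : E → OpenCone P, Continuous F ∧ ∀ z : Metric.sphere (0 : E) 1, F z = f z := by
  classical
  have hmem (z : E) (hz : z ≠ 0) : ‖z‖⁻¹ • z ∈ Metric.sphere (0 : E) 1 := by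
    rw [mem_sphere_zero_iff_norm, norm_smul, norm_inv, norm_norm,
      inv_mul_cancel₀ (norm_ne_zero_iff.2 hz)]
  let F : E → OpenCone P := fun z =>
    if hz : z ≠ 0 then scale ‖z‖ (f ⟨‖z‖⁻¹ • z, hmem z hz⟩) else apex
  refine ⟨F, ?_, fun z => ?_⟩
  · rw [continuous_iff_continuousAt]
    intro z
    by_cases hz : z = 0
    · have hFz : F z = apex := dif_neg (not_not.2 hz)
      refine continuousAt_of_eq_apex hFz ?_
      -- Heights are bounded on the compact sphere, so the scaled heights tend to `0` at the origin.
      -- The bound is replaced by `max M 0` because `M` may be negative when the sphere is empty.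
      obtain ⟨M, hM⟩ := (isCompact_range (continuous_height.comp hf)).bddAbove
      have hle (w : E) : height (F w) ≤ ‖w‖ * max M 0 := by
        by_cases hw : w ≠ 0
        · have hFw : F w = scale ‖w‖ (f ⟨‖w‖⁻¹ • w, hmem w hw⟩) := dif_pos hw
          rw [hFw, height_scale]
          refine max_le (mul_le_mul_of_nonneg_left ?_ (norm_nonneg w)) (by positivity)
          exact (hM ⟨_, rfl⟩).trans (le_max_left _ _)
        · have hFw : F w = apex := dif_neg hw
          rw [hFw, height_apex]
          positivity
      have hlim : Filter.Tendsto (fun w : E => ‖w‖ * max M 0) (𝓝 z) (𝓝 0) := by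
        have : Continuous fun w : E => ‖w‖ * max M 0 := by fun_prop
        simpa [hz] using this.tendsto z
      rw [ContinuousAt, hFz, height_apex]
      exact squeeze_zero (fun _ => height_nonneg _) hle hlim
    · have hon : ContinuousOn F {w | w ≠ 0} := by
        rw [continuousOn_iff_continuous_domRestrict]
        have hnorm : Continuous fun w : {w : E | w ≠ 0} => ‖(w : E)‖ := by fun_prop
        have hdir : Continuous fun w : {w : E | w ≠ 0} =>
            (⟨‖(w : E)‖⁻¹ • (w : E), hmem w w.2⟩ : Metric.sphere (0 : E) 1) :=
          ((hnorm.inv₀ fun w => norm_ne_zero_iff.2 w.2).smul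
            continuous_subtype_val).subtype_mk _
        convert continuous_scale.comp (hnorm.prodMk (hf.comp hdir)) using 1
        ext1 w
        exact dif_pos w.2
      exact hon.continuousAt (isOpen_ne.mem_nhds hz)
  · have h1 : ‖(z : E)‖ = 1 := mem_sphere_zero_iff_norm.1 z.2
    have hz : (z : E) ≠ 0 := norm_ne_zero_iff.1 (by rw [h1]; exact one_ne_zero)
    have hFz : F z = scale ‖(z : E)‖ (f ⟨‖(z : E)‖⁻¹ • (z : E), hmem z hz⟩) := dif_pos hz
    have hdir : (⟨‖(z : E)‖⁻¹ • (z : E), hmem z hz⟩ : Metric.sphere (0 : E) 1) = z :=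
      Subtype.ext (by simp only [h1, inv_one, one_smul])
    rw [hFz, hdir, h1, one_scale]

end OpenCone

/-! ### The `k`-ified cone as a path space. -/

namespace PathFlow

open OpenCone

/-- The path space of the cone of a flow: the `k`-ification of the open cone on its path space. -/
def ConePath (P : Type u) : Type u := OpenCone P

namespace ConePath

variable {P : Type u} [TopologicalSpace P]

instance : TopologicalSpace (ConePath P) :=
  TopologicalSpace.compactlyGenerated.{u} (OpenCone P)

instance : CompactlyGeneratedSpace (ConePath P) :=
  compactlyGeneratedSpace_compactlyGenerated (X := OpenCone P)

instance [WeakHausdorffSpace P] : WeakHausdorffSpace (ConePath P) :=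
  weakHausdorffSpace_compactlyGenerated (X := OpenCone P)

def toOpenCone (q : ConePath P) : OpenCone P := q

def ofOpenCone (q : OpenCone P) : ConePath P := q

theorem continuous_toOpenCone : Continuous (toOpenCone : ConePath P → OpenCone P) :=
  continuous_id_iff_le.2 (compactlyGenerated_le (X := OpenCone P))

theorem continuous_ofOpenCone_comp {K : Type u} [TopologicalSpace K] [CompactSpace K] [T2Space K]
    {g : K → OpenCone P} (hg : Continuous g) : Continuous fun k => ofOpenCone (g k) :=
  hg.to_compactlyGenerated

/-- The inclusion of the base of the cone at varying height is continuous. -/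
theorem continuous_mk [CompactlyGeneratedSpace P] :
    Continuous fun p : unitInterval × P => ofOpenCone (OpenCone.mk p.2 p.1) := by
  have hK (K : Type u) [TopologicalSpace K] [CompactSpace K] [T2Space K] (f : K → P)
      (hf : Continuous f) :
      Continuous fun p : K × unitInterval => ofOpenCone (OpenCone.mk (f p.1) p.2) :=
    continuous_ofOpenCone_comp <| OpenCone.continuous_mk.comp <|
      (hf.comp continuous_fst).prodMk (continuous_subtype_val.comp continuous_snd)
  have hx (x : P) : Continuous fun t : unitInterval => ofOpenCone (OpenCone.mk x t) :=
    (hK PUnit (fun _ => x) continuous_const).comp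
      ((continuous_const (y := PUnit.unit)).prodMk continuous_id)
  -- Currying leaves `P` as the only source, so continuity can be tested on compact Hausdorff spaces
  -- mapping to the `k`-space `P`.
  let G : P → C(unitInterval, ConePath P) := fun x => ⟨_, hx x⟩
  have hG : Continuous G := continuous_from_compactlyGeneratedSpace G fun K _ _ _ f hf =>
    (ContinuousMap.curry ⟨_, hK K f hf⟩).continuous
  exact (ContinuousMap.continuous_uncurry_of_continuous ⟨G, hG⟩).comp continuous_swap

/-- The inclusion of the base of the cone at height `1` is a closed embedding. -/
theorem isClosedEmbedding_mk_one [CompactlyGeneratedSpace P] :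
    IsClosedEmbedding fun x : P => ofOpenCone (OpenCone.mk x 1) := by
  have h : IsClosedEmbedding (toOpenCone ∘ fun x : P => ofOpenCone (OpenCone.mk x 1)) :=
    OpenCone.isClosedEmbedding_mk one_pos
  have hc : Continuous fun x : P => ofOpenCone (OpenCone.mk x 1) :=
    continuous_mk.comp ((continuous_const (y := (1 : unitInterval))).prodMk continuous_id)
  exact ⟨.of_comp hc continuous_toOpenCone h.isEmbedding,
    h.isClosed_range.preimage continuous_toOpenCone⟩

end ConePath

/-! ### The composition law of the cone. -/

variable (A : PathFlow.{u})

open Classical in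
/-- The composition law of the cone of a flow: the height of a composite is the minimum of the
heights, and the composite of paths which are not composable is the apex. -/
noncomputable def coneComp : OpenCone A.Path → OpenCone A.Path → OpenCone A.Path
  | some (x, s), some (y, t) =>
    if h : A.tgt x = A.src y then OpenCone.mk (A.comp x y h) (min s.1 t.1) else none
  | none, _ => none
  | some _, none => none

variable {A}

@[simp] theorem coneComp_apex_left (q : OpenCone A.Path) : A.coneComp apex q = apex := rfl

@[simp] theorem coneComp_apex_right (q : OpenCone A.Path) : A.coneComp q apex = apex := by
  rcases q with _ | _ <;> rfl

theorem coneComp_mk {x y : A.Path} {s t : ℝ} (hs : 0 < s) (ht : 0 < t) (h : A.tgt x = A.src y) :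
    A.coneComp (OpenCone.mk x s) (OpenCone.mk y t) = OpenCone.mk (A.comp x y h) (min s t) := by
  rw [mk_of_pos x hs, mk_of_pos y ht]
  exact dif_pos h

theorem coneComp_mk_of_ne {x y : A.Path} (s t : ℝ) (h : A.tgt x ≠ A.src y) :
    A.coneComp (OpenCone.mk x s) (OpenCone.mk y t) = apex := by
  rcases lt_or_ge 0 s with hs | hs
  · rcases lt_or_ge 0 t with ht | ht
    · rw [mk_of_pos x hs, mk_of_pos y ht]
      exact dif_neg h
    · rw [mk_of_nonpos y ht, coneComp_apex_right]
  · rw [mk_of_nonpos x hs, coneComp_apex_left]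

/-- Only an inequality holds, since non-composable pairs drop to the apex. It suffices to squeeze
the height of the composite to `0` as a factor approaches the apex. -/
theorem height_coneComp_le (p q : OpenCone A.Path) :
    height (A.coneComp p q) ≤ min (height p) (height q) := by
  induction p using rec_mk with
  | apex => simp [height_nonneg]
  | mk x s hs =>
    induction q using rec_mk with
    | apex => simp [height_nonneg]
    | mk y t ht =>
      by_cases h : A.tgt x = A.src y
      · rw [coneComp_mk hs ht h, height_mk_of_pos _ hs, height_mk_of_pos _ ht,
          height_mk_of_pos _ (lt_min hs ht)]
      · rw [coneComp_mk_of_ne s t h]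
        simp [height_nonneg]

/-- Composition in `A` preserves outer sources and targets, so both bracketings are defined in `A`
under the same two conditions. When either condition fails, both sides are the absorbing apex. -/
theorem coneComp_assoc (p q r : OpenCone A.Path) :
    A.coneComp (A.coneComp p q) r = A.coneComp p (A.coneComp q r) := by
  induction p using rec_mk with
  | apex => simp
  | mk x s hs =>
    induction q using rec_mk with
    | apex => simp
    | mk y t ht =>
      induction r using rec_mk with
      | apex => simp
      | mk z v hv =>
        by_cases h : A.tgt x = A.src y
        · rw [coneComp_mk hs ht h]
          by_cases h' : A.tgt y = A.src z
          · rw [coneComp_mk ht hv h',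
              coneComp_mk (lt_min hs ht) hv ((A.tgt_comp x y h).trans h'),
              coneComp_mk hs (lt_min ht hv) (h.trans (A.src_comp y z h').symm),
              A.comp_assoc, min_assoc]
          · rw [coneComp_mk_of_ne t v h', coneComp_apex_right,
              coneComp_mk_of_ne _ _ (by rwa [A.tgt_comp])]
        · rw [coneComp_mk_of_ne s t h, coneComp_apex_left]
          by_cases h' : A.tgt y = A.src z
          · rw [coneComp_mk ht hv h', coneComp_mk_of_ne _ _ (by rwa [A.src_comp])]
          · rw [coneComp_mk_of_ne t v h', coneComp_apex_right]

section Continuity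

variable {K : Type u} [TopologicalSpace K] [CompactSpace K] [T2Space K]

/-- Local form of the continuity of the composition law on compact Hausdorff spaces. -/
theorem continuousAt_comp {a b c : K → A.Path} {k : K} (ha : ∀ᶠ l in 𝓝 k, ContinuousAt a l)
    (hb : ∀ᶠ l in 𝓝 k, ContinuousAt b l)
    (hc : ∀ᶠ l in 𝓝 k, ∃ h : A.tgt (a l) = A.src (b l), c l = A.comp (a l) (b l) h) :
    ContinuousAt c k := by
  -- Composition is continuous only for the `k`-ified fibre product, so the argument restricts to a
  -- compact neighbourhood, from which maps lift to the `k`-ification.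
  obtain ⟨L, hLk, hL, hcomp⟩ := local_compact_nhds (ha.and (hb.and hc))
  have : CompactSpace L := isCompact_iff_compactSpace.1 hcomp
  have haL : Continuous fun l : L => a l :=
    continuousOn_iff_continuous_domRestrict.1 fun l hl => (hL hl).1.continuousWithinAt
  have hbL : Continuous fun l : L => b l :=
    continuousOn_iff_continuous_domRestrict.1 fun l hl => (hL hl).2.1.continuousWithinAt
  let g : L → {p : A.Path × A.Path // A.tgt p.1 = A.src p.2} :=
    fun l => ⟨(a l, b l), (hL l.2).2.2.1⟩
  have hg : Continuous g := (haL.prodMk hbL).subtype_mk _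
  have hcL : ContinuousOn c L := by
    rw [continuousOn_iff_continuous_domRestrict]
    have := @Continuous.comp _ _ _ _
      (TopologicalSpace.compactlyGenerated.{u} {p : A.Path × A.Path // A.tgt p.1 = A.src p.2}) _
      _ _ A.continuous_comp hg.to_compactlyGenerated
    convert this using 1
    ext l
    exact (hL l.2).2.2.2
  exact hcL.continuousAt hLk

theorem continuous_coneComp {p q : K → OpenCone A.Path} (hp : Continuous p) (hq : Continuous q) :
    Continuous fun k => A.coneComp (p k) (q k) := by
  have hhp : Continuous fun k => height (p k) := continuous_height.comp hp
  have hhq : Continuous fun k => height (q k) := continuous_height.comp hq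
  rw [continuous_iff_continuousAt]
  intro k
  rcases le_or_gt (min (height (p k)) (height (q k))) 0 with h0 | h0
  · have hk : A.coneComp (p k) (q k) = apex :=
      eq_apex_of_height_le ((height_coneComp_le _ _).trans h0)
    refine continuousAt_of_eq_apex hk ?_
    have hlim := (hhp.min hhq).tendsto k
    rw [le_antisymm h0 (le_min (height_nonneg _) (height_nonneg _))] at hlim
    rw [ContinuousAt, hk, height_apex]
    exact squeeze_zero (fun _ => height_nonneg _) (fun _ => height_coneComp_le _ _) hlim
  · have hpos : ∀ᶠ l in 𝓝 k, 0 < height (p l) ∧ 0 < height (q l) := by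
      filter_upwards [(hhp.min hhq).continuousAt.eventually (lt_mem_nhds h0)] with l hl
      exact lt_min_iff.1 hl
    have hP : Nonempty A.Path := by
      rcases hpk : p k with _ | ⟨x, t⟩
      · rw [hpk] at h0
        exact absurd (lt_min_iff.1 h0).1 (lt_irrefl _)
      · exact ⟨x⟩
    obtain ⟨x₀⟩ := hP
    let a : K → A.Path := fun l => base x₀ (p l)
    let b : K → A.Path := fun l => base x₀ (q l)
    have ha : ∀ᶠ l in 𝓝 k, ContinuousAt a l := hpos.mono fun l hl =>
      (continuousAt_base x₀ hl.1).comp hp.continuousAt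
    have hb : ∀ᶠ l in 𝓝 k, ContinuousAt b l := hpos.mono fun l hl =>
      (continuousAt_base x₀ hl.2).comp hq.continuousAt
    -- States are discrete, so the target of `a` and the source of `b` are constant near `k`.
    -- Composability at `k` thus decides composability nearby, and the two cases of `coneComp` do
    -- not mix.
    let _ : TopologicalSpace A.State := ⊥
    have : DiscreteTopology A.State := ⟨rfl⟩
    have hta : ∀ᶠ l in 𝓝 k, A.tgt (a l) = A.tgt (a k) :=
      (A.continuous_tgt.continuousAt.comp ha.self_of_nhds).eventually
        (p := fun y => y = _) (by rw [nhds_discrete]; exact Filter.eventually_pure.2 rfl)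
    have hsb : ∀ᶠ l in 𝓝 k, A.src (b l) = A.src (b k) :=
      (A.continuous_src.continuousAt.comp hb.self_of_nhds).eventually
        (p := fun y => y = _) (by rw [nhds_discrete]; exact Filter.eventually_pure.2 rfl)
    have heq (l : K) : A.coneComp (p l) (q l) =
        A.coneComp (OpenCone.mk (a l) (height (p l))) (OpenCone.mk (b l) (height (q l))) := by
      rw [mk_base_height, mk_base_height]
    by_cases h : A.tgt (a k) = A.src (b k)
    · classical
      let c : K → A.Path := fun l =>
        if h : A.tgt (a l) = A.src (b l) then A.comp (a l) (b l) h else x₀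
      have hcomp : ∀ᶠ l in 𝓝 k, A.tgt (a l) = A.src (b l) := by
        filter_upwards [hta, hsb] with l h1 h2
        rw [h1, h2, h]
      have hc : ContinuousAt c k :=
        continuousAt_comp ha hb (hcomp.mono fun l hl => ⟨hl, dif_pos hl⟩)
      refine (hc.openCone_mk (hhp.min hhq).continuousAt h0).congr ?_
      filter_upwards [hpos, hcomp] with l hl hl'
      rw [heq, coneComp_mk hl.1 hl.2 hl']
      exact congrArg (fun x => OpenCone.mk x _) (dif_pos hl')
    · refine (continuousAt_const (y := apex)).congr ?_
      filter_upwards [hta, hsb] with l h1 h2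
      rw [heq, coneComp_mk_of_ne _ _ (by rwa [h1, h2])]

end Continuity

/-! ### The cone flow and the two closed inclusion statements. -/

variable (A) in
/-- The cone of a flow, with a single state. -/
noncomputable def cone : PathFlow.{u} where
  State := PUnit
  Path := ConePath A.Path
  src _ := PUnit.unit
  tgt _ := PUnit.unit
  continuous_src := @continuous_const _ _ _ ⊥ _
  continuous_tgt := @continuous_const _ _ _ ⊥ _
  comp p q _ := ConePath.ofOpenCone (A.coneComp p.toOpenCone q.toOpenCone)
  continuous_comp := continuous_from_compactlyGenerated _ fun _ g =>
    ConePath.continuous_ofOpenCone_comp <| continuous_coneComp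
      (ConePath.continuous_toOpenCone.comp <|
        continuous_fst.comp <| continuous_subtype_val.comp g.continuous)
      (ConePath.continuous_toOpenCone.comp <|
        continuous_snd.comp <| continuous_subtype_val.comp g.continuous)
  src_comp _ _ _ := rfl
  tgt_comp _ _ _ := rfl
  comp_assoc p q r _ _ := coneComp_assoc p.toOpenCone q.toOpenCone r.toOpenCone

/-- The morphism sending every path to the apex of the cone. -/
noncomputable def toApex (X A : PathFlow.{u}) : X ⟶ A.cone :=
  Hom.mk (fun _ => PUnit.unit) (fun _ => ConePath.ofOpenCone apex) continuous_const
    (fun _ => rfl) (fun _ => rfl) (fun _ _ _ => rfl)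

variable (A) in
/-- The morphism from a flow to its cone given by the inclusion at height `t`. -/
noncomputable def toCone (t : unitInterval) : A ⟶ A.cone :=
  Hom.mk (fun _ => PUnit.unit) (fun x => ConePath.ofOpenCone (OpenCone.mk x t))
    (ConePath.continuous_mk.comp (continuous_const.prodMk continuous_id))
    (fun _ => rfl) (fun _ => rfl) (fun x y h => by
      change OpenCone.mk (A.comp x y h) t = A.coneComp (OpenCone.mk x t) (OpenCone.mk y t)
      rcases lt_or_ge 0 (t : ℝ) with ht | ht
      · rw [coneComp_mk ht ht h, min_self]
      · simp only [mk_of_nonpos _ ht, coneComp_apex_left])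

variable (A) in
/-- The S-homotopy from the constant morphism to the inclusion of a flow in its cone. -/
noncomputable def toConeHomotopy : SHomotopy A A.cone where
  toFun := A.toCone
  continuous_onState _ := @continuous_const _ _ _ ⊥ _
  continuous_onPath := ConePath.continuous_mk

theorem toCone_zero : A.toCone 0 = toApex A A :=
  Hom.ext rfl (funext fun x => mk_of_nonpos x le_rfl)

/-- A morphism through which the inclusion in the cone factors is a closed inclusion. -/
theorem closedInclusions_of_comp_eq_toCone {X : PathFlow.{u}} (i : A ⟶ X) (g : X ⟶ A.cone)
    (h : i ≫ g = A.toCone 1) : closedInclusions i := by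
  refine IsClosedEmbedding.of_comp_weakHausdorff (g := g.onPath) i.continuous_onPath
    g.continuous_onPath ?_
  have : g.onPath ∘ i.onPath = (A.toCone 1).onPath := congrArg Hom.onPath h
  rw [this]
  exact ConePath.isClosedEmbedding_mk_one

/-- The homotopy of inclusions at height `t` starts at the constant morphism, which is the
restriction along `i` of the constant morphism on `X`. The extended homotopy at time `1` gives the
required factorization. -/
theorem HasSHEP.closedInclusions {X : PathFlow.{u}} {i : A ⟶ X} (hi : HasSHEP i) :
    closedInclusions i := by
  obtain ⟨H, -, hH⟩ := hi.2 A.cone (toApex X A) A.toConeHomotopy toCone_zero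
  exact closedInclusions_of_comp_eq_toCone i (H.toFun 1) (hH 1)

/-- The morphism from the cone of a flow to the cone of the empty flow has the right lifting
property with respect to the generating cofibrations. -/
theorem rlp_toApex : generatingCofibrations.rlp (toApex A.cone (achronal PEmpty.{u + 1})) := by
  -- The cone of the empty flow has one state and one path, hence is terminal. Lifting therefore
  -- reduces to extending `f` along `i`.
  have hsub : Subsingleton (OpenCone (achronal PEmpty.{u + 1}).Path) :=
    ⟨fun p q => by
      rcases p with _ | ⟨x, _⟩
      · rcases q with _ | ⟨x, _⟩
        · rfl
        · exact x.elim
      · exact x.elim⟩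
  have huniq {X : PathFlow.{u}} (f g : X ⟶ (achronal PEmpty.{u + 1}).cone) : f = g :=
    Hom.ext (Subsingleton.elim (α := X.State → PUnit) _ _)
      (funext fun x => hsub.elim _ _)
  intro X Y i hi
  refine ⟨fun {f g} sq => ?_⟩
  suffices h : ∃ l : Y ⟶ A.cone, i ≫ l = f by
    obtain ⟨l, hl⟩ := h
    exact ⟨⟨l, hl, huniq _ _⟩⟩
  -- Globes contain no composable pairs, so on them only a continuous extension from the sphere to
  -- the disc is needed. For `R` and `C` there are no paths, and the single state of the cone leaves
  -- nothing to choose.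
  cases hi with
  | globe n =>
    let fS : Metric.sphere (0 : EuclideanSpace ℝ (Fin n)) 1 → OpenCone A.Path :=
      fun z => ConePath.toOpenCone (f.onPath (ULift.up z))
    have hfS : Continuous fS := ConePath.continuous_toOpenCone.comp <|
      f.continuous_onPath.comp continuous_uliftUp
    obtain ⟨F, hF, hFf⟩ := OpenCone.exists_extension_sphere hfS
    let G : TopCat.disk.{u} n → OpenCone A.Path := fun z => F z.down.1
    have hG : Continuous G := hF.comp (continuous_subtype_val.comp continuous_uliftDown)
    have : CompactSpace (TopCat.disk.{u} n) := inferInstanceAs (CompactSpace (ULift _))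
    exact ⟨Hom.mk (fun _ => PUnit.unit) (fun z => ConePath.ofOpenCone (G z))
      (ConePath.continuous_ofOpenCone_comp (K := TopCat.disk.{u} n) hG) (fun _ => rfl) (fun _ => rfl)
      (fun _ _ h => absurd (congrArg ULift.down h) Bool.noConfusion),
      Hom.ext rfl (funext fun z => hFf z.down)⟩
  | R => exact ⟨toApex _ _, Hom.ext rfl (funext fun x => x.elim)⟩
  | C => exact ⟨toApex _ _, Hom.ext rfl (funext fun x => x.elim)⟩

/-- A lift in the square whose top is the inclusion at height `1` is an extension of that inclusion
along `i`. -/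
theorem closedInclusions_of_cofibrations {X : PathFlow.{u}} {i : A ⟶ X} (hi : cofibrations i) :
    closedInclusions i := by
  have := hi _ (rlp_toApex (A := A))
  have sq : CommSq (A.toCone 1) i (toApex A.cone (achronal PEmpty.{u + 1})) (toApex X _) := ⟨rfl⟩
  exact closedInclusions_of_comp_eq_toCone i sq.lift sq.fac_left

end PathFlow

theorem mainTheorem8 :
    (∀ {A X : PathFlow.{u}} (i : A ⟶ X), PathFlow.HasSHEP i → PathFlow.closedInclusions i) ∧
      (∀ {A X : PathFlow.{u}} (i : A ⟶ X), PathFlow.cofibrations i → PathFlow.closedInclusions i) := by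
  exact ⟨fun _ => PathFlow.HasSHEP.closedInclusions,
    fun _ => PathFlow.closedInclusions_of_cofibrations⟩
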